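/- Let $Q\ge 2$ be an even integer and let $f:\mathbb Z\to\{-1,1\}$ be $Q$-periodic with $\sum_{y=1}^{Q} f(y)=0$. For a sequence $\varepsilon=(\varepsilon_y)_{y\in\mathbb Z}$ with values in $\{-1,1\}$, let $\mathbb Z^2_\varepsilon$ be the directed graph on $\mathbb Z^2$ in which the edges leaving $(u_1,u_2)$ go to $(u_1,u_2+1)$, $(u_1,u_2-1)$ and $(u_1+\varepsilon_{u_2},u_2)$. The simple random walk on $\mathbb Z^2_\varepsilon$ is the Markov chain that jumps along each of these three edges with probability $1/3$; it is called recurrent if, from every starting point, it almost surely returns to that point infinitely often. Then there exists a deterministic sequence $\lambda=(\lambda_y)_{y\in\mathbb Z}$ with values in $\{0,1\}$ and infinitely many defects, that is, $\|\lambda\|:=\operatorname{card}\{y\in\mathbb Z:\lambda_y=1\}=\infty$, such that the following holds: if $\rho=(\rho_y)_{y\in\mathbb Z}$ is a Rademacher sequence (independent random variables, uniformly distributed on $\{-1,1\}$) and $\varepsilon_y=(1-\lambda_y)f(y)+\lambda_y\rho_y$, then for almost every realisation of $\rho$ the simple random walk on $\mathbb Z^2_\varepsilon$ is recurrent. -/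

import Mathlib

open MeasureTheory ProbabilityTheory Filter
open scoped ENNReal

noncomputable section

/-- The allowed edges of the partially directed lattice `ℤ²_ε`: vertical edges may be used both ways,
the horizontal line at height `y` may only be used in the direction `ε y`. -/
def IsAllowedEdge (ε : ℤ → ℤ) (u v : ℤ × ℤ) : Prop :=
  (v.1 = u.1 ∧ (v.2 = u.2 + 1 ∨ v.2 = u.2 - 1)) ∨ (v.2 = u.2 ∧ v.1 = u.1 + ε u.2)

open scoped Classical in
/-- The transition matrix of the simple random walk on `ℤ²_ε`. -/
def transitionProb (ε : ℤ → ℤ) (u v : ℤ × ℤ) : ℝ≥0∞ :=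
  if IsAllowedEdge ε u v then 3⁻¹ else 0

/-- The out-neighbours of `u` in `ℤ²_ε`. -/
def outNeighbors (ε : ℤ → ℤ) (u : ℤ × ℤ) : Finset (ℤ × ℤ) :=
  {(u.1, u.2 + 1), (u.1, u.2 - 1), (u.1 + ε u.2, u.2)}

theorem mem_outNeighbors_iff (ε : ℤ → ℤ) (u v : ℤ × ℤ) :
    v ∈ outNeighbors ε u ↔ IsAllowedEdge ε u v := by
  obtain ⟨a, b⟩ := u
  obtain ⟨c, d⟩ := v
  simp only [outNeighbors, IsAllowedEdge, Finset.mem_insert, Finset.mem_singleton, Prod.mk.injEq]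
  tauto

theorem card_outNeighbors (ε : ℤ → ℤ) (u : ℤ × ℤ) : (outNeighbors ε u).card = 3 := by
  unfold outNeighbors
  rw [Finset.card_insert_of_notMem, Finset.card_insert_of_notMem, Finset.card_singleton]
  · simp only [Finset.mem_singleton, Prod.mk.injEq]
    omega
  · simp only [Finset.mem_insert, Finset.mem_singleton, Prod.mk.injEq]
    omega

theorem sum_transitionProb (ε : ℤ → ℤ) (u : ℤ × ℤ) :
    ∑ v ∈ outNeighbors ε u, transitionProb ε u v = 1 := by
  have h : ∀ v ∈ outNeighbors ε u, transitionProb ε u v = 3⁻¹ := fun v hv => by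
    rw [transitionProb, if_pos ((mem_outNeighbors_iff ε u v).1 hv)]
  rw [Finset.sum_congr rfl h, Finset.sum_const, card_outNeighbors, nsmul_eq_mul]
  exact ENNReal.mul_inv_cancel (by norm_num) (by norm_num)

/-- The row `v ↦ P(u, v)` of the transition matrix, as a probability mass function. -/
def transitionPMF (ε : ℤ → ℤ) (u : ℤ × ℤ) : PMF (ℤ × ℤ) :=
  PMF.ofFinset (transitionProb ε u) (outNeighbors ε u) (sum_transitionProb ε u)
    (fun v hv => by rw [transitionProb, if_neg (fun h => hv ((mem_outNeighbors_iff ε u v).2 h))])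

/-- The transition kernel of the simple random walk on `ℤ²_ε`. -/
def transitionKernel (ε : ℤ → ℤ) : Kernel (ℤ × ℤ) (ℤ × ℤ) :=
  Kernel.ofFunOfCountable (fun u => (transitionPMF ε u).toMeasure)

instance (ε : ℤ → ℤ) : IsMarkovKernel (transitionKernel ε) :=
  ⟨fun u => inferInstanceAs (IsProbabilityMeasure (transitionPMF ε u).toMeasure)⟩

/-- The transition mechanism of the walk, as a kernel that sees the whole past up to time `n`
but only uses the position at time `n`. -/
def stepKernel (ε : ℤ → ℤ) (n : ℕ) :
    Kernel ((i : Finset.Iic n) → (fun _ : ℕ => ℤ × ℤ) i) (ℤ × ℤ) :=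
  (transitionKernel ε).comap (fun x => x ⟨n, Finset.mem_Iic.2 le_rfl⟩) (measurable_pi_apply _)

instance (ε : ℤ → ℤ) (n : ℕ) : IsMarkovKernel (stepKernel ε n) := by
  unfold stepKernel; infer_instance

/-- The law, on the space of trajectories, of the simple random walk on `ℤ²_ε` started at `u`:
the Markov chain with transition kernel `transitionKernel ε` and initial position `u`. -/
def walkLaw (ε : ℤ → ℤ) (u : ℤ × ℤ) : Measure (ℕ → ℤ × ℤ) :=
  Kernel.traj (X := fun _ : ℕ => ℤ × ℤ) (stepKernel ε) 0 (fun _ => u)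

/-- The simple random walk on `ℤ²_ε` is recurrent: from every starting point it returns
to that point infinitely often, almost surely. -/
def IsRecurrentWalk (ε : ℤ → ℤ) : Prop :=
  ∀ u : ℤ × ℤ, ∀ᵐ M ∂(walkLaw ε u), ∃ᶠ n in atTop, M n = u

/-- A Rademacher sequence indexed by `ℤ`: independent and uniform on `{-1, 1}`. -/
structure IsRademacherSequence {Ω : Type*} [MeasurableSpace Ω] (μ : Measure Ω)
    (ρ : ℤ → Ω → ℤ) : Prop where
  measurable : ∀ y, Measurable (ρ y)
  eq_one_or : ∀ y ω, ρ y ω = 1 ∨ ρ y ω = -1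
  prob_one : ∀ y, μ {ω | ρ y ω = 1} = 2⁻¹
  prob_neg_one : ∀ y, μ {ω | ρ y ω = -1} = 2⁻¹
  indep : iIndepFun ρ μ

/-- The horizontal orientations `ε_y = (1 - lam_y) f(y) + lam_y ρ_y`. -/
def orientation (f lam ρ : ℤ → ℤ) (y : ℤ) : ℤ :=
  (1 - lam y) * f y + lam y * ρ y

/-- The strength `‖lam‖` of the perturbation: the number of defects. -/
def defectStrength (lam : ℤ → ℤ) : ℕ∞ :=
  {y : ℤ | lam y = 1}.encard

end

/-! Sparse defects cannot destroy recurrence, whatever orientations they carry, so randomness plays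
no role. A cutoff argument for a non-symmetric Dirichlet form shows this.

Suppose that within height distance `n` of `o` the orientation has a primitive `D` with `|D| ≤ K`.
The drift part of the form is a sum of `ε v ∂ₓu`. Writing `ε` as the difference of `D` in `y` and
summing by parts in `y`, then in `x`, leaves products `D ∂_y v ∂ₓu` and `D ∂_y u ∂ₓv`, which the
energies control up to `K` (`dirichletForm_le`). Let `u` be the probability of hitting `o` before
leaving the box of radius `n`. Testing the form at `u` against `u` and against a logarithmic cutoff
bounds the escape probability by a constant times `(1 + K²) / harmonicSum n` (`iInf_avoidProb_le`).

The periodic mean-zero part has a bounded primitive, and `k` defects add at most `2k` to it. If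
`harmonicSum (a k) ≥ k³`, boxes reaching just short of the defect `a k` give a bound of order `k² /
k³`, which tends to `0`. -/

/-! ### One-step averages and the Markov property -/

/-- The average of `h` over the three out-neighbours of `p`. -/
noncomputable def stepAvg (ε : ℤ → ℤ) (h : ℤ × ℤ → ℝ≥0∞) (p : ℤ × ℤ) : ℝ≥0∞ :=
  3⁻¹ * (h (p.1, p.2 + 1) + h (p.1, p.2 - 1) + h (p.1 + ε p.2, p.2))

theorem stepAvg_mono (ε : ℤ → ℤ) {g h : ℤ × ℤ → ℝ≥0∞} (hgh : g ≤ h) :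
    stepAvg ε g ≤ stepAvg ε h := fun p => by
  unfold stepAvg
  gcongr <;> exact hgh _

theorem stepAvg_const (ε : ℤ → ℤ) (c : ℝ≥0∞) : stepAvg ε (fun _ => c) = fun _ => c := by
  funext p
  have : (c + c + c) = 3 * c := by ring
  rw [stepAvg, this, ← mul_assoc, ENNReal.inv_mul_cancel (by norm_num) (by norm_num), one_mul]

theorem sum_outNeighbors (ε : ℤ → ℤ) (u : ℤ × ℤ) (h : ℤ × ℤ → ℝ≥0∞) :
    ∑ v ∈ outNeighbors ε u, h v =
      h (u.1, u.2 + 1) + h (u.1, u.2 - 1) + h (u.1 + ε u.2, u.2) := by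
  unfold outNeighbors
  rw [Finset.sum_insert, Finset.sum_insert, Finset.sum_singleton, add_assoc]
  · simp only [Finset.mem_singleton, Prod.mk.injEq]
    omega
  · simp only [Finset.mem_insert, Finset.mem_singleton, Prod.mk.injEq]
    omega

theorem lintegral_transitionKernel (ε : ℤ → ℤ) (u : ℤ × ℤ) (h : ℤ × ℤ → ℝ≥0∞) :
    ∫⁻ v, h v ∂transitionKernel ε u = stepAvg ε h u := by
  have hK : transitionKernel ε u = (transitionPMF ε u).toMeasure := rfl
  rw [hK, lintegral_countable', tsum_eq_sum (s := outNeighbors ε u), stepAvg,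
    ← sum_outNeighbors, Finset.mul_sum]
  · refine Finset.sum_congr rfl fun v hv => ?_
    rw [PMF.toMeasure_apply_singleton _ _ (measurableSet_singleton v), transitionPMF,
      PMF.ofFinset_apply, transitionProb, if_pos ((mem_outNeighbors_iff ε u v).1 hv), mul_comm]
  · intro v hv
    rw [PMF.toMeasure_apply_singleton _ _ (measurableSet_singleton v), transitionPMF,
      PMF.ofFinset_apply, transitionProb,
      if_neg (fun h => hv ((mem_outNeighbors_iff ε u v).2 h)), mul_zero]

instance (ε : ℤ → ℤ) (u : ℤ × ℤ) : IsProbabilityMeasure (walkLaw ε u) := by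
  unfold walkLaw; infer_instance

/-- The Markov property: the joint law of the past up to `n` and the next position is the law of the
past composed with the step kernel. -/
theorem lintegral_walkLaw_mul_succ (ε : ℤ → ℤ) (u : ℤ × ℤ) (n : ℕ)
    (F : (ℕ → ℤ × ℤ) → ℝ≥0∞) (hF : Measurable F)
    (hdep : ∀ M M' : ℕ → ℤ × ℤ, (∀ i ≤ n, M i = M' i) → F M = F M') (h : ℤ × ℤ → ℝ≥0∞) :
    ∫⁻ M, F M * h (M (n + 1)) ∂walkLaw ε u = ∫⁻ M, F M * stepAvg ε h (M n) ∂walkLaw ε u := by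
  have hh : Measurable h := measurable_of_countable h
  -- The value `0` after time `n` is arbitrary, since `F` reads only times up to `n`.
  let ext : ((i : Finset.Iic n) → (fun _ : ℕ => ℤ × ℤ) i) → ℕ → ℤ × ℤ :=
    fun x i => if hi : i ≤ n then x ⟨i, Finset.mem_Iic.2 hi⟩ else 0
  have hext : Measurable ext := by
    refine measurable_pi_lambda _ fun i => ?_
    by_cases hi : i ≤ n
    · simp only [ext, hi, dif_pos]; exact measurable_pi_apply _
    · simp only [ext, hi, dif_neg, not_false_eq_true]; exact measurable_const
  have hFe : ∀ M : ℕ → ℤ × ℤ, F (ext (Preorder.frestrictLe n M)) = F M := fun M =>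
    hdep _ _ fun i hi => by simp [ext, hi]
  have key := Kernel.partialTraj_compProd_eq_map_traj (κ := stepKernel ε) (X := fun _ : ℕ => ℤ × ℤ)
    (Nat.zero_le n) (x₀ := fun _ => u)
  have e1 : ∫⁻ M, F M * h (M (n + 1)) ∂walkLaw ε u =
      ∫⁻ q, F (ext q.1) * h q.2 ∂((walkLaw ε u).map
        (fun M => (Preorder.frestrictLe (π := fun _ : ℕ => ℤ × ℤ) n M, M (n + 1)))) := by
    rw [lintegral_map (by fun_prop) (by fun_prop)]
    simp only [hFe]
  have e2 : ∫⁻ M, F M * stepAvg ε h (M n) ∂walkLaw ε u =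
      ∫⁻ x, F (ext x) * stepAvg ε h (x ⟨n, Finset.mem_Iic.2 le_rfl⟩) ∂((walkLaw ε u).map
        (Preorder.frestrictLe (π := fun _ : ℕ => ℤ × ℤ) n)) := by
    have : Measurable (stepAvg ε h) := measurable_of_countable _
    rw [lintegral_map (by fun_prop) (by fun_prop)]
    simp only [hFe]
    rfl
  rw [e1, e2, walkLaw, ← key, Kernel.traj_map_frestrictLe_apply,
    Measure.lintegral_compProd (by fun_prop)]
  refine lintegral_congr fun x => ?_
  dsimp only
  rw [lintegral_const_mul _ hh, ← lintegral_transitionKernel]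
  rfl

theorem lintegral_walkLaw_succ (ε : ℤ → ℤ) (u : ℤ × ℤ) (n : ℕ) (h : ℤ × ℤ → ℝ≥0∞) :
    ∫⁻ M, h (M (n + 1)) ∂walkLaw ε u = ∫⁻ M, stepAvg ε h (M n) ∂walkLaw ε u := by
  simpa using lintegral_walkLaw_mul_succ ε u n (fun _ => 1) measurable_const (fun _ _ _ => rfl) h

theorem lintegral_walkLaw_zero (ε : ℤ → ℤ) (u : ℤ × ℤ) (h : ℤ × ℤ → ℝ≥0∞) :
    ∫⁻ M, h (M 0) ∂walkLaw ε u = h u := by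
  have hh : Measurable h := measurable_of_countable _
  have e : ∫⁻ M, h (M 0) ∂walkLaw ε u =
      ∫⁻ x, h (x ⟨0, Finset.mem_Iic.2 le_rfl⟩) ∂((walkLaw ε u).map
        (Preorder.frestrictLe (π := fun _ : ℕ => ℤ × ℤ) 0)) := by
    rw [lintegral_map (by fun_prop) (by fun_prop)]
    rfl
  rw [e, walkLaw, Kernel.traj_map_frestrictLe_apply, Kernel.partialTraj_self, Kernel.id_apply,
    lintegral_dirac' _ (by fun_prop)]

/-! ### Probability of not returning, and a criterion for recurrence -/

/-- The probability that the walk started at the given point avoids `o` at times `1, …, n`. -/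
noncomputable def avoidProb (ε : ℤ → ℤ) (o : ℤ × ℤ) : ℕ → ℤ × ℤ → ℝ≥0∞
  | 0 => fun _ => 1
  | n + 1 => stepAvg ε (fun v => if v = o then 0 else avoidProb ε o n v)

theorem avoidProb_antitone (ε : ℤ → ℤ) (o : ℤ × ℤ) : Antitone (avoidProb ε o) := by
  refine antitone_nat_of_succ_le fun n => ?_
  induction n with
  | zero =>
    rw [avoidProb, avoidProb, ← stepAvg_const ε 1]
    exact stepAvg_mono ε fun v => by dsimp only; split_ifs <;> simp [avoidProb]
  | succ n ih =>
    rw [avoidProb, avoidProb]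
    refine stepAvg_mono ε fun v => ?_
    dsimp only
    split_ifs
    · exact le_rfl
    · exact ih v

theorem iInf_avoidProb_eq_stepAvg (ε : ℤ → ℤ) (o p : ℤ × ℤ) :
    ⨅ n, avoidProb ε o n p =
      stepAvg ε (fun v => if v = o then 0 else ⨅ n, avoidProb ε o n v) p := by
  have h (v : ℤ × ℤ) : Tendsto (fun n => avoidProb ε o n v) atTop (nhds (⨅ n, avoidProb ε o n v)) :=
    tendsto_atTop_iInf fun _ _ hmn => avoidProb_antitone ε o hmn v
  have h' (v : ℤ × ℤ) : Tendsto (fun n => if v = o then 0 else avoidProb ε o n v) atTop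
      (nhds (if v = o then 0 else ⨅ n, avoidProb ε o n v)) := by
    split_ifs
    · exact tendsto_const_nhds
    · exact h v
  refine tendsto_nhds_unique ((tendsto_add_atTop_iff_nat 1).2 (h p)) ?_
  exact ENNReal.Tendsto.const_mul (((h' _).add (h' _)).add (h' _)) (Or.inr (by norm_num))

/-- The limiting avoidance probability is harmonic except for the value `0` imposed at `o`. If it
vanishes at `o` anyway, it is harmonic everywhere, and its mean along the walk keeps its initial
value. -/
theorem iInf_avoidProb_eq_zero_along_walk (ε : ℤ → ℤ) (o : ℤ × ℤ)
    (ho : ⨅ n, avoidProb ε o n o = 0) (m : ℕ) :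
    ∫⁻ M, ⨅ n, avoidProb ε o n (M m) ∂walkLaw ε o = 0 := by
  have hharm (p : ℤ × ℤ) : stepAvg ε (fun v => ⨅ n, avoidProb ε o n v) p =
      ⨅ n, avoidProb ε o n p := by
    rw [iInf_avoidProb_eq_stepAvg]
    congr 1
    funext v
    split_ifs with hv
    · rw [hv, ho]
    · rfl
  induction m with
  | zero => rw [lintegral_walkLaw_zero ε o (fun v => ⨅ n, avoidProb ε o n v), ho]
  | succ m ih =>
    rw [lintegral_walkLaw_succ ε o m (fun v => ⨅ n, avoidProb ε o n v)]
    simpa only [hharm] using ih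

theorem lintegral_prod_avoid (ε : ℤ → ℤ) (o : ℤ × ℤ) (m n j : ℕ) :
    ∫⁻ M, (∏ i ∈ Finset.range j, if M (m + i + 1) = o then (0 : ℝ≥0∞) else 1) *
        avoidProb ε o n (M (m + j)) ∂walkLaw ε o =
      ∫⁻ M, (∏ i ∈ Finset.range (j + n), if M (m + i + 1) = o then (0 : ℝ≥0∞) else 1)
        ∂walkLaw ε o := by
  induction n generalizing j with
  | zero => simp [avoidProb]
  | succ n ih =>
    rw [avoidProb, ← lintegral_walkLaw_mul_succ ε o (m + j)
      (fun M => ∏ i ∈ Finset.range j, if M (m + i + 1) = o then (0 : ℝ≥0∞) else 1),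
      ← add_assoc j, add_right_comm j, ← ih (j + 1)]
    · refine lintegral_congr fun M => ?_
      rw [Finset.prod_range_succ, mul_assoc, ← add_assoc]
      congr 1
      split_ifs <;> simp
    · refine Finset.measurable_prod _ fun i _ => ?_
      exact (measurable_of_countable (fun v : ℤ × ℤ => if v = o then (0 : ℝ≥0∞) else 1)).comp
        (measurable_pi_apply _)
    · intro M M' hM
      refine Finset.prod_congr rfl fun i hi => ?_
      rw [hM (m + i + 1) (by have := Finset.mem_range.1 hi; omega)]

/-- By the Markov property, the probability of no visit after time `m` is at most the mean of
`avoidProb ε o n (M m)` for every `n`, and this tends to `0`. Visits after every `m` mean infinitely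
many visits. -/
theorem isRecurrentWalk_of_iInf_avoidProb (ε : ℤ → ℤ)
    (h : ∀ o, ⨅ n, avoidProb ε o n o = 0) : IsRecurrentWalk ε := by
  intro o
  have hN (m : ℕ) : ∀ᵐ M ∂walkLaw ε o, ∃ i, M (m + i + 1) = o := by
    have hle (n : ℕ) : walkLaw ε o {M | ¬ ∃ i, M (m + i + 1) = o} ≤
        ∫⁻ M, avoidProb ε o n (M m) ∂walkLaw ε o := by
      have e := lintegral_prod_avoid ε o m n 0
      simp only [Finset.range_zero, Finset.prod_empty, one_mul, add_zero, zero_add] at e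
      have hs : MeasurableSet {M : ℕ → ℤ × ℤ | ¬ ∃ i, M (m + i + 1) = o} := by
        have : {M : ℕ → ℤ × ℤ | ¬ ∃ i, M (m + i + 1) = o} =
            ⋂ i, {M : ℕ → ℤ × ℤ | M (m + i + 1) = o}ᶜ := by ext; simp
        rw [this]
        exact MeasurableSet.iInter fun i =>
          (measurableSet_eq_fun (measurable_pi_apply _) measurable_const).compl
      rw [e, ← lintegral_indicator_one hs]
      refine lintegral_mono fun M => Set.indicator_le (f := 1) (g := fun M => ∏ i ∈ Finset.range n,
        if M (m + i + 1) = o then (0 : ℝ≥0∞) else 1) (fun M hM => ?_) M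
      rw [Finset.prod_congr rfl fun i _ => if_neg fun hi => hM ⟨i, hi⟩]
      simp
    have hlim : ⨅ n, ∫⁻ M, avoidProb ε o n (M m) ∂walkLaw ε o = 0 := by
      rw [← iInf_avoidProb_eq_zero_along_walk ε o (h o) m]
      refine (lintegral_iInf (fun n => ?_) (fun _ _ hab M => avoidProb_antitone ε o hab (M m)) ?_).symm
      · exact (measurable_of_countable (avoidProb ε o n)).comp (measurable_pi_apply m)
      · simp [avoidProb]
    exact le_antisymm (hlim ▸ le_iInf hle) bot_le
  filter_upwards [ae_all_iff.2 hN] with M hM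
  rw [frequently_atTop]
  intro a
  obtain ⟨i, hi⟩ := hM a
  exact ⟨a + i + 1, by omega, hi⟩

/-! ### Hitting a point before leaving a set -/

/-- The average of a real function over the three out-neighbours of `p`. -/
noncomputable def realAvg (ε : ℤ → ℤ) (h : ℤ × ℤ → ℝ) (p : ℤ × ℤ) : ℝ :=
  (h (p.1, p.2 + 1) + h (p.1, p.2 - 1) + h (p.1 + ε p.2, p.2)) / 3

theorem realAvg_mono (ε : ℤ → ℤ) {g h : ℤ × ℤ → ℝ} (hgh : g ≤ h) :
    realAvg ε g ≤ realAvg ε h := fun p => by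
  have h1 := hgh (p.1, p.2 + 1)
  have h2 := hgh (p.1, p.2 - 1)
  have h3 := hgh (p.1 + ε p.2, p.2)
  unfold realAvg
  linarith

theorem realAvg_const (ε : ℤ → ℤ) (c : ℝ) (p : ℤ × ℤ) : realAvg ε (fun _ => c) p = c := by
  unfold realAvg
  ring

theorem stepAvg_ofReal_one_sub (ε : ℤ → ℤ) (u : ℤ × ℤ → ℝ) (hu : ∀ p, u p ≤ 1) (p : ℤ × ℤ) :
    stepAvg ε (fun v => ENNReal.ofReal (1 - u v)) p = ENNReal.ofReal (1 - realAvg ε u p) := by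
  have h (v) : 0 ≤ 1 - u v := sub_nonneg.2 (hu v)
  have h3 : (3⁻¹ : ℝ≥0∞) = ENNReal.ofReal 3⁻¹ := by
    rw [ENNReal.ofReal_inv_of_pos (by norm_num)]; norm_num
  rw [stepAvg, ← ENNReal.ofReal_add (h _) (h _), ← ENNReal.ofReal_add (add_nonneg (h _) (h _)) (h _),
    h3, ← ENNReal.ofReal_mul (by norm_num), realAvg]
  congr 1
  ring

open scoped Classical in
/-- The probability that the walk started at the given point hits `o` within `n` steps and before
leaving `Λ`. -/
noncomputable def hitProb (ε : ℤ → ℤ) (o : ℤ × ℤ) (Λ : Set (ℤ × ℤ)) : ℕ → ℤ × ℤ → ℝ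
  | 0 => fun p => if p = o then 1 else 0
  | n + 1 => fun p => if p = o then 1 else if p ∈ Λ then realAvg ε (hitProb ε o Λ n) p else 0

section hitProb

variable (ε : ℤ → ℤ) (o : ℤ × ℤ) (Λ : Set (ℤ × ℤ))

theorem hitProb_zero (p : ℤ × ℤ) : hitProb ε o Λ 0 p = if p = o then 1 else 0 := by
  simp [hitProb]

open scoped Classical in
theorem hitProb_succ (n : ℕ) (p : ℤ × ℤ) : hitProb ε o Λ (n + 1) p =
    if p = o then 1 else if p ∈ Λ then realAvg ε (hitProb ε o Λ n) p else 0 := by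
  simp [hitProb]

theorem hitProb_nonneg_le_one (n : ℕ) (p : ℤ × ℤ) :
    0 ≤ hitProb ε o Λ n p ∧ hitProb ε o Λ n p ≤ 1 := by
  induction n generalizing p with
  | zero => rw [hitProb_zero]; split_ifs <;> norm_num
  | succ n ih =>
    have h0 := realAvg_mono ε (g := fun _ => 0) (fun q => (ih q).1) p
    have h1 := realAvg_mono ε (h := fun _ => 1) (fun q => (ih q).2) p
    rw [realAvg_const] at h0 h1
    rw [hitProb_succ]
    split_ifs
    · norm_num
    · exact ⟨h0, h1⟩
    · norm_num

theorem hitProb_monotone : Monotone (hitProb ε o Λ) := by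
  refine monotone_nat_of_le_succ fun n => ?_
  induction n with
  | zero =>
    intro p
    by_cases hp : p = o
    · simp [hitProb, hp]
    · rw [hitProb_zero, if_neg hp]
      exact (hitProb_nonneg_le_one ε o Λ _ p).1
  | succ n ih =>
    intro p
    rw [hitProb_succ, hitProb_succ]
    split_ifs
    · exact le_rfl
    · exact realAvg_mono ε ih p
    · exact le_rfl

theorem avoidProb_le_one_sub_hitProb (n : ℕ) (p : ℤ × ℤ) :
    (if p = o then 0 else avoidProb ε o n p) ≤ ENNReal.ofReal (1 - hitProb ε o Λ n p) := by
  induction n generalizing p with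
  | zero => by_cases hp : p = o <;> simp [hp, hitProb, avoidProb]
  | succ n ih =>
    by_cases hp : p = o
    · simp [hp]
    by_cases hΛ : p ∈ Λ
    · rw [if_neg hp, hitProb_succ, if_neg hp, if_pos hΛ, avoidProb,
        ← stepAvg_ofReal_one_sub ε _ fun q => (hitProb_nonneg_le_one ε o Λ n q).2]
      exact stepAvg_mono ε ih p
    · rw [if_neg hp, hitProb_succ, if_neg hp, if_neg hΛ, sub_zero, ENNReal.ofReal_one]
      exact avoidProb_antitone ε o (Nat.zero_le _) p

/-- The function is the increasing limit of `hitProb`. Passing to the limit in the one-step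
recursion gives harmonicity, and avoiding `o` forever is no likelier than failing to hit it inside
`Λ`. -/
theorem exists_hitting_function :
    ∃ u : ℤ × ℤ → ℝ, u o = 1 ∧ (∀ p ∉ Λ, p ≠ o → u p = 0) ∧
      (∀ p ∈ Λ, p ≠ o → u p = realAvg ε u p) ∧
      ⨅ n, avoidProb ε o n o ≤ ENNReal.ofReal (1 - realAvg ε u o) := by
  have hlim (p : ℤ × ℤ) : Tendsto (fun n => hitProb ε o Λ n p) atTop
      (nhds (⨆ n, hitProb ε o Λ n p)) :=
    tendsto_atTop_ciSup (fun _ _ h => hitProb_monotone ε o Λ h p)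
      ⟨1, by rintro _ ⟨n, rfl⟩; exact (hitProb_nonneg_le_one ε o Λ n p).2⟩
  have havg (p : ℤ × ℤ) : Tendsto (fun n => realAvg ε (hitProb ε o Λ n) p) atTop
      (nhds (realAvg ε (fun q => ⨆ n, hitProb ε o Λ n q) p)) :=
    (((hlim _).add (hlim _)).add (hlim _)).div_const 3
  refine ⟨fun p => ⨆ n, hitProb ε o Λ n p, ?_, fun p hp hpo => ?_, fun p hp hpo => ?_, ?_⟩
  · refine tendsto_nhds_unique (hlim o) (tendsto_const_nhds.congr fun n => ?_)
    cases n <;> simp [hitProb]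
  · refine tendsto_nhds_unique (hlim p) (tendsto_const_nhds.congr fun n => ?_)
    cases n <;> simp [hitProb, hp, hpo]
  · refine tendsto_nhds_unique ((tendsto_add_atTop_iff_nat 1).2 (hlim p))
      ((havg p).congr fun n => ?_)
    simp [hitProb, hp, hpo]
  · refine ge_of_tendsto' (ENNReal.tendsto_ofReal ((havg o).const_sub 1)) fun n => ?_
    refine (iInf_le _ (n + 1)).trans ?_
    rw [← stepAvg_ofReal_one_sub ε _ fun q => (hitProb_nonneg_le_one ε o Λ n q).2, avoidProb]
    exact stepAvg_mono ε (avoidProb_le_one_sub_hitProb ε o Λ n) o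

end hitProb

/-! ### Dirichlet forms and the sector condition -/

/-- The contribution of the edges leaving `p` upwards and to the right to the Dirichlet energy. -/
noncomputable def energyDensity (u : ℤ × ℤ → ℝ) (p : ℤ × ℤ) : ℝ :=
  (u (p.1, p.2 + 1) - u p) ^ 2 + (u (p.1 + 1, p.2) - u p) ^ 2 / 2

/-- The Dirichlet energy of a finitely supported function. -/
noncomputable def energy (u : ℤ × ℤ → ℝ) : ℝ := ∑' p, energyDensity u p

/-- The non-symmetric Dirichlet form of the walk, up to a factor `3`. -/
noncomputable def dirichletForm (ε : ℤ → ℤ) (u v : ℤ × ℤ → ℝ) : ℝ :=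
  ∑' p, v p * (3 * u p - (u (p.1, p.2 + 1) + u (p.1, p.2 - 1) + u (p.1 + ε p.2, p.2)))

theorem hasFiniteSupport_energyDensity {u : ℤ × ℤ → ℝ} (hu : u.HasFiniteSupport) :
    (energyDensity u).HasFiniteSupport := by
  have h3 : (fun p => (u (p.1, p.2 + 1) - u p) * (u (p.1, p.2 + 1) - u p) +
      (u (p.1 + 1, p.2) - u p) * ((u (p.1 + 1, p.2) - u p) / 2)).HasFiniteSupport := by
    fun_prop
      (disch := (rintro ⟨_, _⟩ ⟨_, _⟩ h; simp only [Prod.mk.injEq] at h ⊢; omega))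
  convert h3 using 2 with p
  rw [energyDensity]
  ring

theorem tsum_comp_shift (g : ℤ × ℤ → ℝ) (a b : ℤ) :
    ∑' p : ℤ × ℤ, g (p.1 + a, p.2 + b) = ∑' p, g p :=
  (Equiv.addRight (a, b)).tsum_eq g

theorem energy_comp_shift (u : ℤ × ℤ → ℝ) (a b : ℤ) :
    energy (fun p => u (p.1 + a, p.2 + b)) = energy u := by
  rw [energy, energy, ← tsum_comp_shift (energyDensity u) a b]
  refine tsum_congr fun p => ?_
  simp only [energyDensity, add_right_comm _ (1 : ℤ)]

/-- Discrete integration by parts: coboundaries of finitely supported functions sum to zero. -/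
theorem tsum_le_tsum_of_le_add_coboundary {h g U R : ℤ × ℤ → ℝ} (hh : h.HasFiniteSupport)
    (hg : g.HasFiniteSupport) (hU : U.HasFiniteSupport) (hR : R.HasFiniteSupport)
    (hle : ∀ p : ℤ × ℤ, h p ≤
      g p + (U (p.1, p.2 + 1) - U p) + (R (p.1 + 1, p.2) - R p)) :
    ∑' p, h p ≤ ∑' p, g p := by
  have sum {f : ℤ × ℤ → ℝ} (hf : f.HasFiniteSupport) : Summable f :=
    summable_of_hasFiniteSupport hf
  have eU := tsum_comp_shift U 0 1
  have eR := tsum_comp_shift R 1 0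
  simp only [add_zero] at eU eR
  have hU' : (fun p : ℤ × ℤ => U (p.1, p.2 + 1)).HasFiniteSupport := by
    fun_prop
      (disch := (rintro ⟨_, _⟩ ⟨_, _⟩ h; simp only [Prod.mk.injEq] at h ⊢; omega))
  have hR' : (fun p : ℤ × ℤ => R (p.1 + 1, p.2)).HasFiniteSupport := by
    fun_prop
      (disch := (rintro ⟨_, _⟩ ⟨_, _⟩ h; simp only [Prod.mk.injEq] at h ⊢; omega))
  have s1 := (sum hU').sub (sum hU)
  have s2 := (sum hR').sub (sum hR)
  refine ((sum hh).tsum_le_tsum hle (((sum hg).add s1).add s2)).trans_eq ?_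
  rw [((sum hg).add s1).tsum_add s2, (sum hg).tsum_add s1, (sum hU').tsum_sub (sum hU),
    (sum hR').tsum_sub (sum hR), eU, eR]
  ring

/-- Young's inequality, with `a, b` and `a', b'` the horizontal and vertical increments of `u` and
`v`, and `w, z` horizontal increments of `u` one row up. The weights leave only half the energy of
`u` once `cross_inequality` is added. -/
theorem sector_inequality (K d a b a' b' w z : ℝ) (hd : |d| ≤ K) :
    b * b' + a * a' / 2 + d * b' * (w + z) / 2 ≤
      b ^ 2 / 4 + b' ^ 2 + a ^ 2 / 8 + a' ^ 2 / 2 + (w ^ 2 + z ^ 2) / 16 + 2 * K ^ 2 * b' ^ 2 := by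
  have hK : d ^ 2 * b' ^ 2 ≤ K ^ 2 * b' ^ 2 :=
    mul_le_mul_of_nonneg_right (sq_le_sq' (neg_le_of_abs_le hd) (le_of_abs_le hd)) (sq_nonneg _)
  nlinarith [sq_nonneg (b / 2 - b'), sq_nonneg (a / 2 - a'), sq_nonneg (w - 4 * (d * b')),
    sq_nonneg (z - 4 * (d * b'))]

theorem cross_inequality (K d b w z : ℝ) (hd : |d| ≤ K) :
    -(d * b * (w + z) / 2) ≤ b ^ 2 / 4 + K ^ 2 * (w ^ 2 + z ^ 2) / 2 := by
  have hK : d ^ 2 * (w ^ 2 + z ^ 2) ≤ K ^ 2 * (w ^ 2 + z ^ 2) :=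
    mul_le_mul_of_nonneg_right (sq_le_sq' (neg_le_of_abs_le hd) (le_of_abs_le hd)) (by positivity)
  nlinarith [sq_nonneg (b / 2 + d * w), sq_nonneg (b / 2 + d * z)]

/-- Splits the directed step into a symmetric part, whence the weight `1/2` of horizontal edges in
the energy, and an antisymmetric drift. -/
theorem orientation_step (ε : ℤ → ℤ) (hε : ∀ y, ε y = 1 ∨ ε y = -1) (u : ℤ × ℤ → ℝ) (p : ℤ × ℤ) :
    u (p.1 + ε p.2, p.2) = (u (p.1 + 1, p.2) + u (p.1 - 1, p.2)) / 2 +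
      ε p.2 * (u (p.1 + 1, p.2) - u (p.1 - 1, p.2)) / 2 := by
  rcases hε p.2 with h | h <;> rw [h] <;> push_cast
  · ring
  · rw [← sub_eq_add_neg]; ring

theorem hasFiniteSupport_dirichletForm (ε : ℤ → ℤ) (u : ℤ × ℤ → ℝ) {v : ℤ × ℤ → ℝ}
    (hv : v.HasFiniteSupport) :
    (fun p : ℤ × ℤ => v p * (3 * u p -
      (u (p.1, p.2 + 1) + u (p.1, p.2 - 1) + u (p.1 + ε p.2, p.2)))).HasFiniteSupport := by
  fun_prop

/-- As `ε` is constant on horizontal lines, the drift term at `v = u` telescopes along each line. -/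
theorem energy_le_dirichletForm_self (ε : ℤ → ℤ) (hε : ∀ y, ε y = 1 ∨ ε y = -1)
    {u : ℤ × ℤ → ℝ} (hu : u.HasFiniteSupport) : energy u ≤ dirichletForm ε u u := by
  refine tsum_le_tsum_of_le_add_coboundary (hasFiniteSupport_energyDensity hu)
    (hasFiniteSupport_dirichletForm ε u hu)
    (U := fun p => u p * u p - u p * u (p.1, p.2 - 1))
    (R := fun p => u p * ((1 : ℝ) / 2 * u p - 1 / 2 * u (p.1 - 1, p.2) +
      1 / 2 * (ε p.2 * u (p.1 - 1, p.2)))) (by fun_prop) (by fun_prop) fun p => le_of_eq ?_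
  rw [orientation_step ε hε u p]
  simp only [energyDensity, add_sub_cancel_right]
  ring

/-- The sector condition: if the partial sums of the orientations are bounded, the antisymmetric
part of the Dirichlet form is controlled by the energy. -/
theorem dirichletForm_le (ε : ℤ → ℤ) (hε : ∀ y, ε y = 1 ∨ ε y = -1) (D : ℤ → ℝ) (K : ℝ)
    (hDK : ∀ y, |D y| ≤ K) {u v : ℤ × ℤ → ℝ} (hu : u.HasFiniteSupport) (hv : v.HasFiniteSupport)
    (hD : ∀ p, v p ≠ 0 → D (p.2 + 1) - D p.2 = ε p.2) :
    dirichletForm ε u v ≤ energy u / 2 + (1 + 2 * K ^ 2) * energy v := by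
  have su := hasFiniteSupport_energyDensity hu
  have sv := hasFiniteSupport_energyDensity hv
  have sum {f : ℤ × ℤ → ℝ} (hf : f.HasFiniteSupport) : Summable f :=
    summable_of_hasFiniteSupport hf
  have e : energy u / 2 + (1 + 2 * K ^ 2) * energy v =
      ∑' p, ((1 : ℝ) / 2 * energyDensity u p + (1 + 2 * K ^ 2) * energyDensity v p) := by
    rw [((sum su).mul_left _).tsum_add ((sum sv).mul_left _), tsum_mul_left, tsum_mul_left,
      energy, energy]
    ring
  rw [e, dirichletForm]
  -- The terms of `U` and `R` linear in `v` or `D` perform the summations by parts. The pure squares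
  -- move `w², z²` back to the increments at `p`, so that they can be counted in the energy density
  -- there.
  refine tsum_le_tsum_of_le_add_coboundary (hasFiniteSupport_dirichletForm ε u hv)
    (by fun_prop)
    (U := fun p => v p * (u (p.1, p.2 - 1) - u p -
        1 / 2 * (D p.2 * (u (p.1 + 1, p.2) - u (p.1 - 1, p.2)))) +
      (u (p.1 + 1, p.2) - u p) * ((1 : ℝ) / 8 * (u (p.1 + 1, p.2) - u p)))
    (R := fun p => v p * (1 / 2 * (u (p.1 - 1, p.2) - u p)) +
      1 / 2 * (D (p.2 + 1) * (v (p.1 - 1, p.2) * (u (p.1, p.2 + 1) - u p) +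
        v p * (u (p.1 - 1, p.2 + 1) - u (p.1 - 1, p.2)))) -
      (u (p.1, p.2 + 1) - u (p.1 - 1, p.2 + 1)) *
        ((1 : ℝ) / 16 * (u (p.1, p.2 + 1) - u (p.1 - 1, p.2 + 1))) -
      (v p - v (p.1 - 1, p.2)) * (1 / 2 * K ^ 2 * (v p - v (p.1 - 1, p.2))))
    (by fun_prop
      (disch := (rintro ⟨_, _⟩ ⟨_, _⟩ h; simp only [Prod.mk.injEq] at h ⊢; omega)))
    (by fun_prop
      (disch := (rintro ⟨_, _⟩ ⟨_, _⟩ h; simp only [Prod.mk.injEq] at h ⊢; omega)))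
    fun p => ?_
  have hvD : v p * (D (p.2 + 1) - D p.2) = v p * ε p.2 := by
    by_cases h : v p = 0
    · rw [h, zero_mul, zero_mul]
    · rw [hD p h]
  have h1 := sector_inequality K (D (p.2 + 1)) (u (p.1 + 1, p.2) - u p) (u (p.1, p.2 + 1) - u p)
    (v (p.1 + 1, p.2) - v p) (v (p.1, p.2 + 1) - v p)
    (u (p.1 + 1, p.2 + 1) - u (p.1, p.2 + 1)) (u (p.1, p.2 + 1) - u (p.1 - 1, p.2 + 1)) (hDK _)
  have h2 := cross_inequality K (D (p.2 + 1)) (u (p.1, p.2 + 1) - u p)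
    (v (p.1 + 1, p.2) - v p) (v p - v (p.1 - 1, p.2)) (hDK _)
  rw [orientation_step ε hε u p]
  simp only [energyDensity, add_sub_cancel_right]
  have h3 : v p * (ε p.2 * (u (p.1 + 1, p.2) - u (p.1 - 1, p.2)) / 2) =
      v p * (D (p.2 + 1) - D p.2) * (u (p.1 + 1, p.2) - u (p.1 - 1, p.2)) / 2 := by
    rw [hvD]; ring
  linear_combination h1 + h2 - h3

/-! ### Logarithmic cutoff functions -/

/-- The partial sums of the harmonic series. -/
noncomputable def harmonicSum (n : ℕ) : ℝ := ∑ i ∈ Finset.range n, 1 / ((i : ℝ) + 1)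

theorem harmonicSum_succ (n : ℕ) : harmonicSum (n + 1) = harmonicSum n + 1 / ((n : ℝ) + 1) :=
  Finset.sum_range_succ _ _

theorem one_div_succ_le_one (n : ℕ) : 1 / ((n : ℝ) + 1) ≤ 1 := by
  rw [div_le_one (by positivity)]
  linarith [(Nat.cast_nonneg n : (0 : ℝ) ≤ n)]

theorem one_le_harmonicSum {n : ℕ} (hn : 1 ≤ n) : 1 ≤ harmonicSum n := by
  induction n, hn using Nat.le_induction with
  | base => simp [harmonicSum]
  | succ n _ ih =>
    rw [harmonicSum_succ]
    have : 0 ≤ 1 / ((n : ℝ) + 1) := by positivity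
    linarith

theorem harmonicSum_add_le (n m : ℕ) : harmonicSum (n + m) ≤ harmonicSum n + m := by
  induction m with
  | zero => simp
  | succ m ih =>
    rw [← add_assoc, harmonicSum_succ]
    push_cast
    have := one_div_succ_le_one (n + m)
    push_cast at this
    linarith

/-- A radial profile which decreases from `1` at `0` to `0` at `n` like a logarithm. -/
noncomputable def logProfile (n r : ℕ) : ℝ :=
  (harmonicSum n - harmonicSum (min r n)) / harmonicSum n

/-- The sup norm on `ℤ²`. -/
def supRadius (p : ℤ × ℤ) : ℕ := max p.1.natAbs p.2.natAbs

/-- The logarithmic cutoff function on the box of radius `n` around the origin. -/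
noncomputable def logCutoff (n : ℕ) (p : ℤ × ℤ) : ℝ := logProfile n (supRadius p)

theorem logCutoff_zero {n : ℕ} (hn : 1 ≤ n) : logCutoff n 0 = 1 := by
  have := one_le_harmonicSum hn
  simp only [logCutoff, logProfile, supRadius, Prod.fst_zero, Prod.snd_zero, Int.natAbs_zero,
    max_self, Nat.zero_min]
  rw [harmonicSum, harmonicSum, Finset.range_zero, Finset.sum_empty, sub_zero]
  exact div_self (by rw [harmonicSum] at this; linarith)

theorem logCutoff_eq_zero {n : ℕ} {p : ℤ × ℤ} (hp : n ≤ supRadius p) : logCutoff n p = 0 := by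
  rw [logCutoff, logProfile, min_eq_right hp, sub_self, zero_div]

theorem hasFiniteSupport_of_supRadius {u : ℤ × ℤ → ℝ} (n : ℕ)
    (hu : ∀ p, n ≤ supRadius p → u p = 0) : u.HasFiniteSupport := by
  refine (Set.finite_Icc (-(n : ℤ), -(n : ℤ)) ((n : ℤ), (n : ℤ))).subset fun p hp => ?_
  have : ¬ n ≤ supRadius p := fun h => hp (hu p h)
  simp only [supRadius, le_max_iff, not_or] at this
  simp only [Set.mem_Icc, Prod.le_def]
  omega

theorem logProfile_sub_sq_le {n : ℕ} (hn : 1 ≤ n) (r s : ℕ) (hrs : r ≤ s + 1) (hsr : s ≤ r + 1) :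
    (logProfile n s - logProfile n r) ^ 2 ≤
      if r ≤ n then 4 / (((r : ℝ) + 1) ^ 2 * harmonicSum n ^ 2) else 0 := by
  have hH := one_le_harmonicSum hn
  have step (k : ℕ) : logProfile n k - logProfile n (k + 1) =
      if k < n then 1 / (((k : ℝ) + 1) * harmonicSum n) else 0 := by
    unfold logProfile
    split_ifs with hk
    · rw [min_eq_left hk.le, min_eq_left (show k + 1 ≤ n from hk), harmonicSum_succ]
      field_simp
      ring
    · rw [min_eq_right (by omega), min_eq_right (by omega), sub_self]
  have hpos : (0 : ℝ) ≤ if r ≤ n then 4 / (((r : ℝ) + 1) ^ 2 * harmonicSum n ^ 2) else 0 := by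
    split_ifs <;> positivity
  rcases (by omega : s = r ∨ s = r + 1 ∨ r = s + 1) with rfl | rfl | rfl
  · simpa using hpos
  · rw [← neg_sub, neg_sq, step]
    by_cases hr : r < n
    · rw [if_pos hr, if_pos hr.le, div_pow, one_pow, mul_pow]
      gcongr
      norm_num
    · rw [if_neg hr, zero_pow two_ne_zero]
      exact hpos
  · rw [step]
    by_cases hs : s < n
    · rw [if_pos hs, if_pos (show s + 1 ≤ n from hs), div_pow, one_pow, mul_pow,
        div_le_div_iff₀ (by positivity) (by positivity), one_mul, ← mul_assoc 4]
      refine mul_le_mul_of_nonneg_right ?_ (by positivity)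
      push_cast
      -- The constant `4` comes from `s + 2 ≤ 2 (s + 1)`.
      nlinarith [(Nat.cast_nonneg s : (0 : ℝ) ≤ s)]
    · rw [if_neg hs, if_neg (show ¬ s + 1 ≤ n from hs), zero_pow two_ne_zero]

theorem energyDensity_logCutoff_le {n : ℕ} (hn : 1 ≤ n) (p : ℤ × ℤ) :
    energyDensity (logCutoff n) p ≤
      if supRadius p ≤ n then 6 / (((supRadius p : ℝ) + 1) ^ 2 * harmonicSum n ^ 2) else 0 := by
  have h1 := logProfile_sub_sq_le hn (supRadius p) (supRadius (p.1, p.2 + 1))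
    (by simp only [supRadius]; omega) (by simp only [supRadius]; omega)
  have h2 := logProfile_sub_sq_le hn (supRadius p) (supRadius (p.1 + 1, p.2))
    (by simp only [supRadius]; omega) (by simp only [supRadius]; omega)
  unfold energyDensity logCutoff
  split_ifs at h1 h2 ⊢ with h
  · have : 6 / (((supRadius p : ℝ) + 1) ^ 2 * harmonicSum n ^ 2) =
      4 / (((supRadius p : ℝ) + 1) ^ 2 * harmonicSum n ^ 2) +
      4 / (((supRadius p : ℝ) + 1) ^ 2 * harmonicSum n ^ 2) / 2 := by ring
    linarith
  · linarith

theorem card_box_le (r : ℕ) : ((Finset.box r : Finset (ℤ × ℤ)).card : ℝ) ≤ 8 * ((r : ℝ) + 1) := by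
  rcases Nat.eq_zero_or_pos r with rfl | hr
  · simp
  · rw [Int.card_box hr.ne']
    push_cast
    linarith

/-- The sphere of radius `r` has at most `8 (r + 1)` points, each of density at most `6 / ((r + 1)
H)²` with `H = harmonicSum n`. Summing over `r ≤ n` leaves a harmonic sum, which cancels one factor
`H`. -/
theorem energy_logCutoff_le {n : ℕ} (hn : 1 ≤ n) :
    energy (logCutoff n) ≤ 96 / harmonicSum n := by
  have hH := one_le_harmonicSum hn
  have hzero (p : ℤ × ℤ) (hp : n < supRadius p) : energyDensity (logCutoff n) p = 0 := by
    refine le_antisymm ?_ (by unfold energyDensity; positivity)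
    simpa [not_le.2 hp] using energyDensity_logCutoff_le hn p
  let s : Finset (ℤ × ℤ) := (Finset.range (n + 1)).biUnion Finset.box
  have hs (p : ℤ × ℤ) : p ∈ s ↔ supRadius p < n + 1 := by
    simp [s, Int.mem_box, supRadius]
  have hmaps : ∀ p ∈ s, supRadius p ∈ Finset.range (n + 1) := fun p hp =>
    Finset.mem_range.2 ((hs p).1 hp)
  rw [energy, tsum_eq_sum (s := s) fun p hp => hzero p (by rw [hs] at hp; omega),
    ← Finset.sum_fiberwise_of_maps_to hmaps]
  have hr (r : ℕ) (hr : r ∈ Finset.range (n + 1)) :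
      ∑ p ∈ s with supRadius p = r, energyDensity (logCutoff n) p ≤
        48 / harmonicSum n ^ 2 * (1 / ((r : ℝ) + 1)) := by
    have hsub : (s.filter fun p => supRadius p = r) ⊆ Finset.box r := fun p hp =>
      Int.mem_box.2 (Finset.mem_filter.1 hp).2
    refine (Finset.sum_le_card_nsmul _ _ (6 / (((r : ℝ) + 1) ^ 2 * harmonicSum n ^ 2))
      fun p hp => ?_).trans ?_
    · have h := energyDensity_logCutoff_le hn p
      rw [(Finset.mem_filter.1 hp).2, if_pos (by have := Finset.mem_range.1 hr; omega)] at h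
      exact h
    · rw [nsmul_eq_mul]
      have hc : ((s.filter fun p => supRadius p = r).card : ℝ) ≤ 8 * ((r : ℝ) + 1) :=
        le_trans (by exact_mod_cast Finset.card_le_card hsub) (card_box_le r)
      refine (mul_le_mul_of_nonneg_right hc (by positivity)).trans_eq ?_
      field_simp
      norm_num
  refine (Finset.sum_le_sum hr).trans ?_
  rw [← Finset.mul_sum, ← harmonicSum, harmonicSum_succ]
  have h1 := one_div_succ_le_one n
  calc 48 / harmonicSum n ^ 2 * (harmonicSum n + 1 / ((n : ℝ) + 1))
      ≤ 48 / harmonicSum n ^ 2 * (2 * harmonicSum n) := by gcongr; linarith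
    _ = 96 / harmonicSum n := by field_simp; norm_num

/-! ### The recurrence criterion -/

theorem iInf_avoidProb_le (ε : ℤ → ℤ) (hε : ∀ y, ε y = 1 ∨ ε y = -1) (o : ℤ × ℤ) {n : ℕ}
    (hn : 1 ≤ n) (D : ℤ → ℝ) (K : ℝ) (hDK : ∀ y, |D y| ≤ K)
    (hD : ∀ y, |y - o.2| < n → D (y + 1) - D y = ε y) :
    ⨅ m, avoidProb ε o m o ≤ ENNReal.ofReal (64 * (1 + 2 * K ^ 2) / harmonicSum n) := by
  let Λ : Set (ℤ × ℤ) := {p | supRadius (p.1 - o.1, p.2 - o.2) < n}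
  obtain ⟨u, huo, hu0, huh, hle⟩ := exists_hitting_function ε o Λ
  refine hle.trans (ENNReal.ofReal_le_ofReal ?_)
  have hoΛ : o ∈ Λ := by
    simp only [Λ, Set.mem_ofPred_eq, sub_self, supRadius, Int.natAbs_zero, max_self]
    omega
  let f : ℤ × ℤ → ℝ := fun p => logCutoff n (p.1 + -o.1, p.2 + -o.2)
  have hfo : f o = 1 := by
    simp only [f, add_neg_cancel]
    exact logCutoff_zero hn
  have hfΛ (p) (hp : p ∉ Λ) : f p = 0 := logCutoff_eq_zero (not_lt.1 hp)
  have huΛ (p) (hp : p ∉ Λ) : u p = 0 := hu0 p hp fun h => hp (h ▸ hoΛ)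
  have hfin {g : ℤ × ℤ → ℝ} (hg : ∀ p ∉ Λ, g p = 0) : g.HasFiniteSupport := by
    refine hasFiniteSupport_of_supRadius (n + o.1.natAbs + o.2.natAbs) fun p hp => hg p fun h => ?_
    simp only [Λ, Set.mem_ofPred_eq, supRadius] at h hp
    omega
  -- Harmonicity of `u` on `Λ` away from `o` and vanishing of `v` off `Λ` leave only the term at
  -- `o`.
  have hform {v : ℤ × ℤ → ℝ} (hv : ∀ p ∉ Λ, v p = 0) (hvo : v o = 1) :
      dirichletForm ε u v = 3 * (1 - realAvg ε u o) := by
    rw [dirichletForm, tsum_eq_single o fun p hp => ?_, hvo, huo, realAvg]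
    · ring
    · by_cases hpΛ : p ∈ Λ
      · have := huh p hpΛ hp
        rw [realAvg] at this
        rw [this]
        ring
      · rw [hv p hpΛ, zero_mul]
  have h1 := energy_le_dirichletForm_self ε hε (hfin huΛ)
  have h2 := dirichletForm_le ε hε D K hDK (hfin huΛ) (hfin hfΛ) fun p hp => hD _ ?_
  · have h3 : energy f ≤ 96 / harmonicSum n :=
      (energy_comp_shift (logCutoff n) (-o.1) (-o.2)).trans_le (energy_logCutoff_le hn)
    rw [hform huΛ huo] at h1
    rw [hform hfΛ hfo] at h2
    -- With `e` the escape probability `1 - realAvg ε u o`, `h1` gives `energy u ≤ 3e`, so half of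
    -- the `3e` in `h2` is absorbed; `64 = 96 · 2/3`.
    have h4 := mul_le_mul_of_nonneg_left h3 (show 0 ≤ 1 + 2 * K ^ 2 by positivity)
    have h5 : 64 * (1 + 2 * K ^ 2) / harmonicSum n =
      2 / 3 * ((1 + 2 * K ^ 2) * (96 / harmonicSum n)) := by ring
    linarith
  · have hpΛ : p ∈ Λ := by_contra fun h => hp (hfΛ p h)
    simp only [Λ, Set.mem_ofPred_eq, supRadius] at hpΛ
    rw [abs_lt]
    omega

theorem isRecurrentWalk_of_small (ε : ℤ → ℤ) (hε : ∀ y, ε y = 1 ∨ ε y = -1)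
    (h : ∀ (b : ℤ) (η : ℝ), 0 < η → ∃ (n : ℕ) (D : ℤ → ℝ) (K : ℝ), 1 ≤ n ∧ (∀ y, |D y| ≤ K) ∧
      (∀ y, |y - b| < n → D (y + 1) - D y = ε y) ∧ 64 * (1 + 2 * K ^ 2) / harmonicSum n ≤ η) :
    IsRecurrentWalk ε := by
  refine isRecurrentWalk_of_iInf_avoidProb ε fun o => ?_
  refine le_antisymm (ENNReal.le_of_forall_pos_le_add fun η hη _ => ?_) bot_le
  obtain ⟨n, D, K, hn, hDK, hD, hle⟩ := h o.2 η hη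
  refine (iInf_avoidProb_le ε hε o hn D K hDK hD).trans ?_
  rw [zero_add]
  exact ENNReal.ofReal_le_of_le_toReal (by simpa using hle)

/-! ### Periodic orientations with sparse defects -/

/-- Summing `f` from `0` to `y` modulo `Q` gives a periodic function; the mean-zero condition makes
it a primitive across the wrap-around too. -/
theorem exists_bounded_primitive (Q : ℕ) (hQ : 2 ≤ Q) (f : ℤ → ℤ) (hf : ∀ y, f y = 1 ∨ f y = -1)
    (hper : Function.Periodic f (Q : ℤ)) (hsum : ∑ y ∈ Finset.Icc (1 : ℤ) (Q : ℤ), f y = 0) :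
    ∃ F : ℤ → ℝ, (∀ y, |F y| ≤ Q) ∧ ∀ y, F (y + 1) - F y = f y := by
  have hQ0 : (0 : ℤ) < Q := by omega
  have hmod (y : ℤ) : f (y % Q) = f y := by
    have h := hper.int_mul (y / Q) (y % Q)
    rw [← h]
    congr 1
    rw [mul_comm]
    exact Int.emod_add_mul_ediv y Q
  have hzero : ∑ i ∈ Finset.range Q, f i = 0 := by
    have h1 : ∑ y ∈ Finset.Icc (1 : ℤ) (Q : ℤ), f y = ∑ i ∈ Finset.range Q, f (i + 1 : ℤ) := by
      refine (Finset.sum_bij (fun (i : ℕ) _ => (i : ℤ) + 1) ?_ ?_ ?_ fun _ _ => rfl).symm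
      · intro i hi
        simp only [Finset.mem_range, Finset.mem_Icc] at hi ⊢
        omega
      · intro i _ j _ h
        omega
      · intro y hy
        simp only [Finset.mem_Icc] at hy
        exact ⟨(y - 1).toNat, by simp only [Finset.mem_range]; omega, by omega⟩
    have h2 := Finset.sum_range_succ (fun i : ℕ => f i) Q
    have h3 := Finset.sum_range_succ' (fun i : ℕ => f i) Q
    have h4 : f (Q : ℤ) = f 0 := by simpa using hper 0
    push_cast at h3
    rw [← h1, hsum] at h3
    linarith
  refine ⟨fun y => ((∑ i ∈ Finset.range (y % Q).toNat, f i : ℤ) : ℝ), fun y => ?_, fun y => ?_⟩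
  · have hlt : (y % Q).toNat ≤ Q := by
      have := Int.emod_lt_of_pos y hQ0
      omega
    push_cast
    refine (Finset.abs_sum_le_sum_abs _ _).trans ?_
    calc ∑ i ∈ Finset.range (y % Q).toNat, |(f i : ℝ)|
        = ∑ i ∈ Finset.range (y % Q).toNat, (1 : ℝ) := by
          refine Finset.sum_congr rfl fun i _ => ?_
          rcases hf i with h | h <;> simp [h]
      _ ≤ Q := by simpa using hlt
  · have h0 := Int.emod_nonneg y hQ0.ne'
    have hlt := Int.emod_lt_of_pos y hQ0
    have hdiv := Int.emod_add_mul_ediv y Q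
    have hsucc : ∑ i ∈ Finset.range ((y % Q).toNat + 1), f i =
        ∑ i ∈ Finset.range (y % Q).toNat, f i + f y := by
      rw [Finset.sum_range_succ, Int.toNat_of_nonneg h0, hmod]
    rw [← Int.cast_sub, Int.cast_inj]
    by_cases hy : y % Q + 1 < Q
    · have : (y + 1) % Q = y % Q + 1 := by
        rw [Int.add_emod, Int.emod_eq_of_lt (a := 1) (by omega) (by omega),
          Int.emod_eq_of_lt (by omega) hy]
      rw [this, show (y % (Q : ℤ) + 1).toNat = (y % Q).toNat + 1 by omega, hsucc]
      ring
    · have : (y + 1) % Q = 0 := by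
        rw [Int.add_emod, Int.emod_eq_of_lt (a := 1) (by omega) (by omega),
          show y % (Q : ℤ) + 1 = Q by omega, Int.emod_self]
      rw [show (y % (Q : ℤ)).toNat + 1 = Q by omega, hzero] at hsucc
      rw [this, Int.toNat_zero, Finset.range_zero, Finset.sum_empty]
      linarith

/-- Below height `a k` only the first `k` defects are met, and each is a jump of size at most `2`.
-/
theorem exists_defect_primitive (a : ℕ → ℕ) (ha : StrictMono a) (g : ℤ → ℤ) (hg : ∀ y, |g y| ≤ 2)
    (hg0 : ∀ y : ℤ, (∀ k, y ≠ a k) → g y = 0) (k : ℕ) :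
    ∃ G : ℤ → ℝ, (∀ y, |G y| ≤ 2 * k) ∧ ∀ y < (a k : ℤ), G (y + 1) - G y = g y := by
  refine ⟨fun y => ∑ j ∈ Finset.range k, if (a j : ℤ) < y then (g (a j) : ℝ) else 0,
    fun y => ?_, fun y hy => ?_⟩
  · refine (Finset.abs_sum_le_sum_abs _ _).trans ?_
    refine (Finset.sum_le_card_nsmul _ _ 2 fun j _ => ?_).trans_eq ?_
    · split_ifs
      · exact_mod_cast hg (a j)
      · norm_num
    · rw [Finset.card_range, nsmul_eq_mul, mul_comm]
  · rw [← Finset.sum_sub_distrib]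
    have hterm (j : ℕ) : ((if (a j : ℤ) < y + 1 then (g (a j) : ℝ) else 0) -
        if (a j : ℤ) < y then (g (a j) : ℝ) else 0) = if y = (a j : ℤ) then (g y : ℝ) else 0 := by
      rcases lt_trichotomy (a j : ℤ) y with h | h | h
      · rw [if_pos (by omega), if_pos h, if_neg (by omega), sub_self]
      · rw [if_pos (by omega), if_neg (by omega), if_pos h.symm, h, sub_zero]
      · rw [if_neg (by omega), if_neg (by omega), if_neg (by omega), sub_self]
    rw [Finset.sum_congr rfl fun j _ => hterm j]
    by_cases h : ∃ i, y = a i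
    · obtain ⟨i, rfl⟩ := h
      have hi : i < k := ha.lt_iff_lt.1 (by exact_mod_cast hy)
      rw [Finset.sum_eq_single i]
      · rw [if_pos rfl]
      · intro j _ hji
        exact if_neg fun h => hji (ha.injective (by exact_mod_cast h.symm))
      · intro h
        exact absurd (Finset.mem_range.2 hi) h
    · push Not at h
      rw [hg0 y h, Int.cast_zero]
      simp

/-- The primitive bound grows linearly in `k` and enters squared, so a cubic lower bound suffices;
the harmonic series diverges. -/
theorem exists_sparse_sequence :
    ∃ a : ℕ → ℕ, StrictMono a ∧ ∀ k : ℕ, (k : ℝ) ^ 3 ≤ harmonicSum (a k) :=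
  extraction_forall_of_eventually fun k =>
    (Real.tendsto_sum_range_one_div_nat_succ_atTop.eventually_ge_atTop ((k : ℝ) ^ 3))

/-- The walk is recurrent for every choice of the orientations on sufficiently sparse defects. -/
theorem isRecurrentWalk_of_sparse_defects (Q : ℕ) (hQ : 2 ≤ Q) (f : ℤ → ℤ)
    (hf : ∀ y, f y = 1 ∨ f y = -1) (hper : Function.Periodic f (Q : ℤ))
    (hsum : ∑ y ∈ Finset.Icc (1 : ℤ) (Q : ℤ), f y = 0) (a : ℕ → ℕ) (ha : StrictMono a)
    (hharm : ∀ k : ℕ, (k : ℝ) ^ 3 ≤ harmonicSum (a k)) (ε : ℤ → ℤ)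
    (hε : ∀ y, ε y = 1 ∨ ε y = -1) (hεf : ∀ y : ℤ, (∀ k, y ≠ a k) → ε y = f y) :
    IsRecurrentWalk ε := by
  obtain ⟨F, hFK, hF⟩ := exists_bounded_primitive Q hQ f hf hper hsum
  refine isRecurrentWalk_of_small ε hε fun b η hη => ?_
  -- Here `2432 = 64 · 19 · 2`: `1 + 2 (3k)² ≤ 19 k²` once `Q ≤ k`, and the factor `2` pays for
  -- shrinking the radius by `|b|`.
  obtain ⟨k, hk⟩ := exists_nat_ge (max (2432 / η) (Q + 2 * (b.natAbs : ℝ) + 1))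
  have hk1 := (le_max_left _ _).trans hk
  have hk2 := (le_max_right _ _).trans hk
  have hk3 : Q + 2 * b.natAbs + 1 ≤ k := by exact_mod_cast hk2
  have hak : k ≤ a k := ha.le_apply
  obtain ⟨G, hGK, hG⟩ := exists_defect_primitive a ha (fun y => ε y - f y)
    (fun y => by rcases hε y with h | h <;> rcases hf y with h' | h' <;> rw [h, h'] <;> norm_num)
    (fun y hy => sub_eq_zero.2 (hεf y hy)) k
  -- This radius keeps all heights around `b` below `a k`, where `G` is a primitive.
  refine ⟨a k - b.natAbs, fun y => F y + G y, Q + 2 * k, by omega, fun y => ?_, fun y hy => ?_, ?_⟩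
  · exact (abs_add_le _ _).trans (add_le_add (hFK y) (hGK y))
  · have h1 := hF y
    have h2 := hG y (by rw [abs_lt] at hy; omega)
    push_cast at h2
    linarith
  · have h1 := harmonicSum_add_le (a k - b.natAbs) b.natAbs
    rw [Nat.sub_add_cancel (by omega)] at h1
    have h2 := hharm k
    have hb : (0 : ℝ) ≤ b.natAbs := by positivity
    have hQr : (0 : ℝ) ≤ Q := by positivity
    have hk0 : (1 : ℝ) ≤ k := by linarith
    have h3 : (k : ℝ) ≤ (k : ℝ) ^ 3 := le_self_pow₀ hk0 (by norm_num)
    have h4 : (k : ℝ) ^ 3 / 2 ≤ harmonicSum (a k - b.natAbs) := by linarith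
    have h5 : 1 + 2 * ((Q : ℝ) + 2 * k) ^ 2 ≤ 19 * (k : ℝ) ^ 2 := by
      have : ((Q : ℝ) + 2 * k) ^ 2 ≤ (3 * (k : ℝ)) ^ 2 := by gcongr; linarith
      nlinarith
    rw [div_le_iff₀ hη] at hk1
    have hkpos : (0 : ℝ) < (k : ℝ) ^ 3 / 2 := by positivity
    rw [div_le_iff₀ (hkpos.trans_le h4)]
    calc 64 * (1 + 2 * ((Q : ℝ) + 2 * k) ^ 2) ≤ 64 * (19 * (k : ℝ) ^ 2) := by gcongr
      _ = 2432 * ((k : ℝ) ^ 2 / 2) := by ring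
      _ ≤ k * η * ((k : ℝ) ^ 2 / 2) := by gcongr
      _ = η * ((k : ℝ) ^ 3 / 2) := by ring
      _ ≤ η * harmonicSum (a k - b.natAbs) := by gcongr

theorem mainTheorem3 (Q : ℕ) (hQ : 2 ≤ Q) (hQeven : Even Q)
    (f : ℤ → ℤ) (hf : ∀ y, f y = 1 ∨ f y = -1) (hper : Function.Periodic f (Q : ℤ))
    (hsum : ∑ y ∈ Finset.Icc (1 : ℤ) (Q : ℤ), f y = 0) :
    ∃ lam : ℤ → ℤ, (∀ y, lam y = 0 ∨ lam y = 1) ∧ defectStrength lam = ⊤ ∧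
      ∀ (Ω : Type*) [MeasurableSpace Ω] (μ : Measure Ω) [IsProbabilityMeasure μ]
        (ρ : ℤ → Ω → ℤ), IsRademacherSequence μ ρ →
        ∀ᵐ ω ∂μ, IsRecurrentWalk (orientation f lam (fun y => ρ y ω)) := by
  classical
  obtain ⟨a, ha, hharm⟩ := exists_sparse_sequence
  refine ⟨fun y => if ∃ k, y = a k then 1 else 0, fun y => ?_, ?_, ?_⟩
  · dsimp only
    split_ifs
    · exact Or.inr rfl
    · exact Or.inl rfl
  · rw [defectStrength, Set.encard_eq_top_iff]
    refine (Set.infinite_range_of_injective (f := fun k => (a k : ℤ)) fun i j h =>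
      ha.injective (Int.ofNat_inj.1 h)).mono ?_
    rintro _ ⟨k, rfl⟩
    exact if_pos ⟨k, rfl⟩
  · intro Ω _ μ _ ρ hρ
    -- Recurrence holds for every realisation.
    refine ae_of_all μ fun ω => isRecurrentWalk_of_sparse_defects Q hQ f hf hper hsum a ha hharm _
      (fun y => ?_) fun y hy => ?_
    · simp only [orientation]
      split_ifs
      · simpa using hρ.eq_one_or y ω
      · simpa using hf y
    · have : ¬ ∃ k, y = a k := fun ⟨k, hk⟩ => hy k hk
      simp [orientation, this]
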